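/- Let $d\ge 1$. For every $x\in\mathbb R^d$ let $\Xi(x)$ be a probability distribution (depending measurably on $x$) on a measurable space, and let $F(x;\xi)$ be a jointly measurable real-valued oracle such that, for a function $f:\mathbb R^d\to\mathbb R$, a number $\sigma$ and all $x\in\mathbb R^d$, $$\mathbb E_{\xi\sim\Xi(x)}[F(x;\xi)]=f(x),\qquad \mathbb E_{\xi\sim\Xi(x)}\big[|F(x;\xi)-f(x)|^2\big]\le\sigma^2 .$$ Assume that $f$ is $L$-Lipschitz for the Euclidean norm. Let $\delta>0$, $\eta>0$, and let $M\ge 1$ and $K$ be natural numbers; put $D=\delta/M$ and $T=KM$. Consider ZO-O2NC with the one-point estimator (Option II). Set $x_0=y_0=0$, draw $u_0$ uniformly on the unit sphere $\mathbb S^{d-1}$ and then $\xi_0\sim\Xi(y_0+\delta u_0)$. For $t=1,\dots,T$: if $t=(k-1)M+1$ for some integer $k\ge 1$ (the start of a block), set $\Delta_t=0$ (this replaces the value computed at the end of iteration $t-1$); draw $s_t$ uniformly on $[0,1]$, independently of everything drawn before; set $$y_t=x_{t-1}+s_t\Delta_t,\qquad x_t=x_{t-1}+\Delta_t;$$ draw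 $u_t$ uniformly on $\mathbb S^{d-1}$, independently of everything drawn before; draw $\xi_t$ with conditional law $\Xi(y_t+\delta u_t)$ given everything drawn before; set $$g_t=\frac d\delta\big(F(y_t+\delta u_t;\xi_t)-F(y_{t-1}+\delta u_{t-1};\xi_{t-1})\big)u_t,\qquad \Delta_{t+1}=\Pi_{\mathbb B(0,D)}(\Delta_t-\eta g_t),$$ where $\Pi_{\mathbb B(0,D)}$ is the Euclidean projection onto the closed ball of radius $D$ centred at $0$. Then, for every $1\le t\le T$, $\|y_t-y_{t-1}\|\le 2D$, and $\|g_t\|^2$ is integrable with $$\mathbb E\big[\|g_t\|^2\big]\le\frac{6d^2\sigma^2}{\delta^2}+385\,d^2L^2 .$$ -/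

import Mathlib

open MeasureTheory ProbabilityTheory

namespace ZOO2NC

/-- The decision space `ℝ^d` with its Euclidean norm. -/
abbrev E (d : ℕ) : Type := EuclideanSpace ℝ (Fin d)

/-- The unit sphere of `ℝ^d`. -/
abbrev Sph (d : ℕ) : Type := Metric.sphere (0 : E d) 1

/-- The uniform distribution on the unit sphere: normalized surface measure. -/
noncomputable def unifSphere (d : ℕ) : Measure (Sph d) :=
  ((volume : Measure (E d)).toSphere Set.univ)⁻¹ • (volume : Measure (E d)).toSphere

/-- Euclidean projection onto the closed ball of radius `D` about the origin
(see `projBall_mem` and `projBall_unique`). -/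
noncomputable def projBall {d : ℕ} (D : ℝ) (v : E d) : E d :=
  if ‖v‖ ≤ D then v else (D / ‖v‖) • v

theorem projBall_mem {d : ℕ} {D : ℝ} (hD : 0 ≤ D) (v : E d) :
    projBall D v ∈ Metric.closedBall (0 : E d) D := by
  unfold projBall
  rw [mem_closedBall_zero_iff]
  split_ifs with h
  · exact h
  · have hv : 0 < ‖v‖ := lt_of_le_of_lt hD (not_le.mp h)
    rw [norm_smul, Real.norm_of_nonneg (by positivity), div_mul_cancel₀ _ hv.ne']

/-- `projBall D v` is the unique point of the ball at least distance from `v`. -/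
theorem projBall_unique {d : ℕ} {D : ℝ} (hD : 0 ≤ D) (v w : E d)
    (hw : w ∈ Metric.closedBall (0 : E d) D) (hne : w ≠ projBall D v) :
    ‖v - projBall D v‖ < ‖v - w‖ := by
  rw [mem_closedBall_zero_iff] at hw
  unfold projBall at hne ⊢
  split_ifs at hne ⊢ with h
  · rw [sub_self, norm_zero, norm_pos_iff, sub_ne_zero]
    exact fun e => hne e.symm
  · have hv : 0 < ‖v‖ := lt_of_le_of_lt hD (not_le.mp h)
    have e1 : ‖v - (D / ‖v‖) • v‖ = ‖v‖ - D := by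
      have h1 : v - (D / ‖v‖) • v = (1 - D / ‖v‖) • v := by rw [sub_smul, one_smul]
      have h2 : 0 ≤ 1 - D / ‖v‖ := by
        rw [sub_nonneg, div_le_one hv]
        exact (not_le.mp h).le
      rw [h1, norm_smul, Real.norm_of_nonneg h2]
      field_simp
    rw [e1]
    by_contra hcon
    have hle : ‖v - w‖ ≤ ‖v‖ - D := not_lt.mp hcon
    have hsq := norm_sub_sq_real v w
    have hcs := real_inner_le_norm v w
    have h3 : ‖v‖ - ‖w‖ ≤ ‖v - w‖ := norm_sub_norm_le v w
    have hwD : ‖w‖ = D := le_antisymm hw (by linarith)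
    have hin : inner ℝ v w = ‖v‖ * ‖w‖ := by
      have := norm_nonneg (v - w)
      nlinarith
    have h4 := inner_eq_norm_mul_iff_real.mp hin
    apply hne
    rw [hwD] at h4
    rw [div_eq_inv_mul, mul_smul, h4, smul_smul, inv_mul_cancel₀ hv.ne', one_smul]

/-- The one-point residual estimator
`(d/δ) (F(y + δu; ξ) - F(y' + δu'; ξ')) u`. -/
noncomputable def onePoint {d : ℕ} {Z : Type*} (F : E d → Z → ℝ) (δ : ℝ)
    (y : E d) (u : Sph d) (ξ : Z) (y' : E d) (u' : Sph d) (ξ' : Z) : E d :=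
  (((d : ℝ) / δ) * (F (y + δ • (u : E d)) ξ - F (y' + δ • (u' : E d)) ξ')) • (u : E d)

/-- The variables held at the end of iteration `t`: `x = x_t`, `y = y_t`, `g = g_t`, and
`next`, the value given to `Δ_{t+1}` by the projected update at the end of iteration `t`. -/
structure State (d : ℕ) where
  x : E d
  y : E d
  g : E d
  next : E d

/-- The method with the one-point estimator, along one sample path of the interpolation weights
`s 1, s 2, …`, the directions `u 0, u 1, …` and the samples `ξ 0, ξ 1, …`. Iteration `t + 1` is
the first one of a block of length `M` iff `M ∣ t`; then `Δ_{t+1}` is reset to `0`.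
State `0` is the initialization `x_0 = y_0 = 0`; its other two fields are never used. -/
noncomputable def state {d : ℕ} {Z : Type*} (F : E d → Z → ℝ) (δ η : ℝ) (M : ℕ)
    (s : ℕ → unitInterval) (u : ℕ → Sph d) (ξ : ℕ → Z) : ℕ → State d
  | 0 => { x := 0, y := 0, g := 0, next := 0 }
  | t + 1 =>
    let S := state F δ η M s u ξ t
    let Δ : E d := if M ∣ t then 0 else S.next
    let y : E d := S.x + (s (t + 1) : ℝ) • Δ
    let g : E d := onePoint F δ y (u (t + 1)) (ξ (t + 1)) S.y (u t) (ξ t)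
    { x := S.x + Δ
      y := y
      g := g
      next := projBall (δ / M) (Δ - η • g) }

/-- The iterate `y_t` as a random vector. -/
noncomputable def yIter {d : ℕ} {Z Ω : Type*} (F : E d → Z → ℝ) (δ η : ℝ) (M : ℕ)
    (s : ℕ → Ω → unitInterval) (u : ℕ → Ω → Sph d) (ξ : ℕ → Ω → Z) (t : ℕ) (ω : Ω) : E d :=
  (state F δ η M (fun i => s i ω) (fun i => u i ω) (fun i => ξ i ω) t).y

/-- The gradient estimator `g_t` (for `t ≥ 1`) as a random vector. -/
noncomputable def gIter {d : ℕ} {Z Ω : Type*} (F : E d → Z → ℝ) (δ η : ℝ) (M : ℕ)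
    (s : ℕ → Ω → unitInterval) (u : ℕ → Ω → Sph d) (ξ : ℕ → Ω → Z) (t : ℕ) (ω : Ω) : E d :=
  (state F δ η M (fun i => s i ω) (fun i => u i ω) (fun i => ξ i ω) t).g

/-- The σ-algebra generated by `s i` for `1 ≤ i < a`, `u i` for `i < b` and `ξ i` for `i < c`. -/
@[reducible] def hist {d : ℕ} {Z Ω : Type*} [MeasurableSpace Z]
    (s : ℕ → Ω → unitInterval) (u : ℕ → Ω → Sph d) (ξ : ℕ → Ω → Z) (a b c : ℕ) :
    MeasurableSpace Ω :=
  (⨆ i ∈ Set.Ico 1 a, MeasurableSpace.comap (s i) inferInstance) ⊔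
    (⨆ i ∈ Set.Iio b, MeasurableSpace.comap (u i) inferInstance) ⊔
    (⨆ i ∈ Set.Iio c, MeasurableSpace.comap (ξ i) inferInstance)

/-- `X` has conditional law `κ (q ω)` given the sub-σ-algebra `m`:
`P(A ∩ {X ∈ B}) = ∫_A κ(q(ω), B) dP(ω)` for all `A ∈ m` and all measurable `B`. -/
def HasCondLaw {Ω Z Q : Type*} [MeasurableSpace Ω] [MeasurableSpace Z] [MeasurableSpace Q]
    (P : Measure Ω) (m : MeasurableSpace Ω) (X : Ω → Z) (κ : Kernel Q Z) (q : Ω → Q) : Prop :=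
  ∀ A : Set Ω, MeasurableSet[m] A → ∀ B : Set Z, MeasurableSet B →
    P (A ∩ X ⁻¹' B) = ∫⁻ ω in A, κ (q ω) B ∂P

/-- The stochastic zeroth-order oracle: under `ξ ∼ Ξ(x)` the value `F(x; ξ)` has mean `f x` and
variance at most `σ²`, for every `x`. -/
structure IsSZO {d : ℕ} {Z : Type*} [MeasurableSpace Z] (F : E d → Z → ℝ)
    (Ξ : Kernel (E d) Z) (f : E d → ℝ) (σ : ℝ) : Prop where
  integrable : ∀ x, Integrable (F x) (Ξ x)
  mean : ∀ x, ∫ z, F x z ∂(Ξ x) = f x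
  integrable_sq : ∀ x, Integrable (fun z => |F x z - f x| ^ 2) (Ξ x)
  variance : ∀ x, ∫ z, |F x z - f x| ^ 2 ∂(Ξ x) ≤ σ ^ 2

/-- The random inputs of a run of `K` blocks of length `M` are sampled as the method says.
In iteration `t` (`1 ≤ t ≤ K M`) a weight `s t` uniform on `[0,1]` is drawn first, independently
of everything drawn before; then a direction `u t` uniform on the sphere, independently of
everything drawn before; then `ξ t` from `Ξ(y_t + δ u_t)`, conditionally on everything drawn
before. The initialization `t = 0` draws only `u 0` and `ξ 0`. -/
structure IsRun {d : ℕ} {Z Ω : Type*} [MeasurableSpace Z] [MeasurableSpace Ω]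
    (F : E d → Z → ℝ) (Ξ : Kernel (E d) Z) (δ η : ℝ) (M K : ℕ) (P : Measure Ω)
    (s : ℕ → Ω → unitInterval) (u : ℕ → Ω → Sph d) (ξ : ℕ → Ω → Z) : Prop where
  measurable_s : ∀ t, Measurable (s t)
  measurable_u : ∀ t, Measurable (u t)
  measurable_ξ : ∀ t, Measurable (ξ t)
  law_s : ∀ t, 1 ≤ t → t ≤ K * M → P.map (s t) = (volume : Measure unitInterval)
  indep_s : ∀ t, 1 ≤ t → t ≤ K * M →
    Indep (MeasurableSpace.comap (s t) inferInstance) (hist s u ξ t t t) P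
  law_u : ∀ t, t ≤ K * M → P.map (u t) = unifSphere d
  indep_u : ∀ t, t ≤ K * M →
    Indep (MeasurableSpace.comap (u t) inferInstance) (hist s u ξ (t + 1) t t) P
  law_ξ : ∀ t, t ≤ K * M →
    HasCondLaw P (hist s u ξ (t + 1) (t + 1) t) (ξ t) Ξ
      (fun ω => yIter F δ η M s u ξ t ω + δ • (u t ω : E d))

end ZOO2NC

namespace ZOO2NC

/-! Write `z_t = y_t + δ u_t` for the query points. As `‖u_t‖ = 1`, `‖g_t‖²` is `(d/δ)²` times the
square of the difference of two consecutive oracle values. That difference is (noise at `t`) -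
(noise at `t-1`) + (`f z_t - f z_{t-1}`), and the square of a sum of three terms is at most three
times the sum of their squares. Each noise has second moment at most `σ²`, because `ξ_t` has law
`Ξ(z_t)` given a history that determines `z_t` (`IsSZO.noise_sq`). The drift of `f` is bounded on
every path: the iterates move by at most `2D ≤ 2δ` and the perturbations by at most `2δ`, so it is
at most `4δ|L|` (`norm_query_succ_sub_le`). The total is `(d/δ)²(6σ² + 48δ²L²)`, so `48` already
serves in place of `385`. -/

theorem measurable_projBall {d : ℕ} (D : ℝ) : Measurable (projBall D : E d → E d) := by
  unfold projBall
  exact Measurable.ite (measurableSet_le measurable_norm measurable_const) measurable_id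
    ((measurable_const.div measurable_norm).smul measurable_id)

/-! ### Displacement bounds along a sample path -/

section Path

variable {d : ℕ} {Z : Type*} (F : E d → Z → ℝ) {δ : ℝ} (η : ℝ) (M : ℕ)
  (s : ℕ → unitInterval) (u : ℕ → Sph d) (ξ : ℕ → Z)

theorem norm_state_next_le (hδ : 0 ≤ δ) (t : ℕ) :
    ‖(state F δ η M s u ξ t).next‖ ≤ δ / M := by
  cases t with
  | zero => simpa [state] using (by positivity : 0 ≤ δ / (M : ℝ))
  | succ t => exact mem_closedBall_zero_iff.mp (projBall_mem (by positivity) _)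

/-- The increment `Δ_{t+1}` used in iteration `t + 1` has norm at most `D = δ / M`. -/
theorem norm_increment_le (hδ : 0 ≤ δ) (t : ℕ) :
    ‖(if M ∣ t then 0 else (state F δ η M s u ξ t).next : E d)‖ ≤ δ / M := by
  split_ifs
  · simpa using (by positivity : 0 ≤ δ / (M : ℝ))
  · exact norm_state_next_le F η M s u ξ hδ t

theorem norm_state_x_sub_y_le (hδ : 0 ≤ δ) (t : ℕ) :
    ‖(state F δ η M s u ξ t).x - (state F δ η M s u ξ t).y‖ ≤ δ / M := by
  cases t with
  | zero => simpa [state] using (by positivity : 0 ≤ δ / (M : ℝ))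
  | succ t =>
    simp only [state]
    have h := norm_increment_le F η M s u ξ hδ t
    set Δ : E d := if M ∣ t then 0 else (state F δ η M s u ξ t).next
    have hs := (s (t + 1)).2
    calc ‖(state F δ η M s u ξ t).x + Δ
            - ((state F δ η M s u ξ t).x + (s (t + 1) : ℝ) • Δ)‖
        = ‖(1 - (s (t + 1) : ℝ)) • Δ‖ := by congr 1; module
      _ ≤ 1 * ‖Δ‖ := by
        rw [norm_smul, Real.norm_of_nonneg (by linarith [hs.2])]
        gcongr
        linarith [hs.1]
      _ ≤ δ / M := by rwa [one_mul]

/-- The path from `y_t` to `y_{t+1}` passes through `x_t`: the first leg is the unused fraction `(1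
- s_t)Δ_t` of the old increment, the second is `s_{t+1}Δ_{t+1}`. A block reset only replaces an
increment by `0`, so both legs stay within `D`. -/
theorem norm_state_y_succ_sub_le (hδ : 0 ≤ δ) (t : ℕ) :
    ‖(state F δ η M s u ξ (t + 1)).y - (state F δ η M s u ξ t).y‖ ≤ 2 * (δ / M) := by
  have h := norm_increment_le F η M s u ξ hδ t
  have hxy := norm_state_x_sub_y_le F η M s u ξ hδ t
  simp only [state]
  set Δ : E d := if M ∣ t then 0 else (state F δ η M s u ξ t).next
  have hs := (s (t + 1)).2
  have hsΔ : ‖(s (t + 1) : ℝ) • Δ‖ ≤ δ / M := by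
    rw [norm_smul, Real.norm_of_nonneg hs.1]
    exact (mul_le_of_le_one_left (norm_nonneg _) hs.2).trans h
  calc _ = ‖((state F δ η M s u ξ t).x - (state F δ η M s u ξ t).y)
          + (s (t + 1) : ℝ) • Δ‖ := by congr 1; module
    _ ≤ _ := (norm_add_le _ _).trans (by linarith)

end Path

/-! ### Measurability with respect to the history -/

section Measurability

variable {d : ℕ} {Z Ω : Type*} [MeasurableSpace Z]

/-- The point `y_t + δ u_t` at which the oracle is queried in iteration `t`. -/
noncomputable def query (F : E d → Z → ℝ) (δ η : ℝ) (M : ℕ)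
    (s : ℕ → Ω → unitInterval) (u : ℕ → Ω → Sph d) (ξ : ℕ → Ω → Z) (t : ℕ) (ω : Ω) : E d :=
  yIter F δ η M s u ξ t ω + δ • (u t ω : E d)

/-- The σ-algebra `m` is arbitrary so that both the ambient one and `hist` can be used. The split
records timing: `x_t` and `y_t` are fixed before `u_t` and `ξ_t` are drawn, while `g_t` and `next`
need them. -/
theorem measurable_state {F : E d → Z → ℝ} (hF : Measurable (Function.uncurry F)) (δ η : ℝ)
    (M : ℕ) {m : MeasurableSpace Ω}
    {s : ℕ → Ω → unitInterval} {u : ℕ → Ω → Sph d} {ξ : ℕ → Ω → Z} (t : ℕ)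
    (hs : ∀ i, 1 ≤ i → i ≤ t → Measurable[m] (s i))
    (hu : ∀ i < t, Measurable[m] (u i)) (hξ : ∀ i < t, Measurable[m] (ξ i)) :
    Measurable[m] (fun ω => (state F δ η M (s · ω) (u · ω) (ξ · ω) t).x) ∧
    Measurable[m] (fun ω => (state F δ η M (s · ω) (u · ω) (ξ · ω) t).y) ∧
    (Measurable[m] (u t) → Measurable[m] (ξ t) →
      Measurable[m] (fun ω => (state F δ η M (s · ω) (u · ω) (ξ · ω) t).g) ∧
      Measurable[m] (fun ω => (state F δ η M (s · ω) (u · ω) (ξ · ω) t).next)) := by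
  induction t with
  | zero =>
    exact ⟨measurable_const, measurable_const, fun _ _ => ⟨measurable_const, measurable_const⟩⟩
  | succ t ih =>
    obtain ⟨hx, hy, hgn⟩ := ih (fun i h1 h2 => hs i h1 (by omega))
      (fun i hi => hu i (by omega)) (fun i hi => hξ i (by omega))
    obtain ⟨-, hn⟩ := hgn (hu t (by omega)) (hξ t (by omega))
    have hΔ : Measurable[m] (fun ω => (if M ∣ t then 0 else
        (state F δ η M (s · ω) (u · ω) (ξ · ω) t).next : E d)) := by
      split_ifs
      · exact measurable_const
      · exact hn
    have hst : Measurable[m] (fun ω => (s (t + 1) ω : ℝ)) :=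
      measurable_subtype_coe.comp (hs (t + 1) (by omega) le_rfl)
    have hy' : Measurable[m] (fun ω => (state F δ η M (s · ω) (u · ω) (ξ · ω) (t + 1)).y) :=
      hx.add (hst.smul hΔ)
    refine ⟨hx.add hΔ, hy', fun hut hξt => ?_⟩
    have hu1 : Measurable[m] (fun ω => (u (t + 1) ω : E d)) := measurable_subtype_coe.comp hut
    have hu0 : Measurable[m] (fun ω => (u t ω : E d)) :=
      measurable_subtype_coe.comp (hu t (by omega))
    have hg : Measurable[m] (fun ω => (state F δ η M (s · ω) (u · ω) (ξ · ω) (t + 1)).g) :=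
      (((hF.comp ((hy'.add (hu1.const_smul δ)).prodMk hξt)).sub
        (hF.comp ((hy.add (hu0.const_smul δ)).prodMk (hξ t (by omega))))).const_mul _).smul hu1
    exact ⟨hg, (measurable_projBall _).comp (hΔ.sub (hg.const_smul η))⟩

theorem measurable_query {F : E d → Z → ℝ} (hF : Measurable (Function.uncurry F)) (δ η : ℝ)
    (M : ℕ) {m : MeasurableSpace Ω}
    {s : ℕ → Ω → unitInterval} {u : ℕ → Ω → Sph d} {ξ : ℕ → Ω → Z} (t : ℕ)
    (hs : ∀ i, 1 ≤ i → i ≤ t → Measurable[m] (s i))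
    (hu : ∀ i ≤ t, Measurable[m] (u i)) (hξ : ∀ i < t, Measurable[m] (ξ i)) :
    Measurable[m] (query F δ η M s u ξ t) :=
  (measurable_state hF δ η M t hs (fun i hi => hu i hi.le) hξ).2.1.add
    ((measurable_subtype_coe.comp (hu t le_rfl)).const_smul δ)

variable (s : ℕ → Ω → unitInterval) (u : ℕ → Ω → Sph d) (ξ : ℕ → Ω → Z) {a b c i : ℕ}

theorem measurable_hist_s (h1 : 1 ≤ i) (h : i < a) : Measurable[hist s u ξ a b c] (s i) := by
  rw [measurable_iff_comap_le]
  exact (le_iSup₂_of_le (f := fun i (_ : i ∈ Set.Ico 1 a) => MeasurableSpace.comap (s i) _)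
    i ⟨h1, h⟩ le_rfl).trans (le_sup_left.trans le_sup_left)

theorem measurable_hist_u (h : i < b) : Measurable[hist s u ξ a b c] (u i) := by
  rw [measurable_iff_comap_le]
  exact (le_iSup₂_of_le (f := fun i (_ : i ∈ Set.Iio b) => MeasurableSpace.comap (u i) _)
    i h le_rfl).trans (le_sup_right.trans le_sup_left)

theorem measurable_hist_ξ (h : i < c) : Measurable[hist s u ξ a b c] (ξ i) := by
  rw [measurable_iff_comap_le]
  exact (le_iSup₂_of_le (f := fun i (_ : i ∈ Set.Iio c) => MeasurableSpace.comap (ξ i) _)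
    i h le_rfl).trans le_sup_right

end Measurability

/-! ### Second moment of the oracle noise -/

/-- If `X` has conditional law `κ (q ω)` given `m` and `q` is `m`-measurable, then the joint law
of `(q, X)` is the composition-product of the law of `q` and `κ`. -/
theorem HasCondLaw.map_prodMk {Ω Z Q : Type*} {m : MeasurableSpace Ω} [MeasurableSpace Ω]
    [MeasurableSpace Z]
    [MeasurableSpace Q] {P : Measure Ω} [IsFiniteMeasure P] {X : Ω → Z}
    {κ : Kernel Q Z} [IsMarkovKernel κ] {q : Ω → Q} (h : HasCondLaw P m X κ q)
    (hX : Measurable X) (hq : Measurable q) (hqm : Measurable[m] q) :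
    P.map (fun ω => (q ω, X ω)) = (P.map q).compProd κ := by
  -- Rectangles suffice, and on `A × B` the claim is `h` for the event `q ⁻¹' A`, which lies in `m`.
  refine Measure.ext_prod fun {A B} hA hB => ?_
  rw [Measure.map_apply (hq.prodMk hX) (hA.prod hB), Measure.compProd_apply_prod hA hB,
    setLIntegral_map hA (κ.measurable_coe hB) hq]
  exact h _ (hqm hA) B hB

/-- Querying the oracle at an `m`-measurable random point gives a noise of second moment at most
`σ²`. -/
theorem IsSZO.noise_sq {d : ℕ} {Ω Z : Type*} {m : MeasurableSpace Ω} [MeasurableSpace Ω]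
    [MeasurableSpace Z]
    {F : E d → Z → ℝ} {Ξ : Kernel (E d) Z} [IsMarkovKernel Ξ] {f : E d → ℝ} {σ : ℝ}
    (hSZO : IsSZO F Ξ f σ) (hF : Measurable (Function.uncurry F)) (hf : Measurable f)
    {P : Measure Ω} [IsProbabilityMeasure P] {X : Ω → Z} {q : Ω → E d}
    (h : HasCondLaw P m X Ξ q) (hX : Measurable X) (hq : Measurable q)
    (hqm : Measurable[m] q) :
    Integrable (fun ω => |F (q ω) (X ω) - f (q ω)| ^ 2) P ∧
      ∫ ω, |F (q ω) (X ω) - f (q ω)| ^ 2 ∂P ≤ σ ^ 2 := by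
  have hG : Measurable (fun p : E d × Z => |F p.1 p.2 - f p.1| ^ 2) :=
    ((hF.sub (hf.comp measurable_fst)).abs).pow_const 2
  -- The Lebesgue integral of a nonnegative function needs no prior integrability, so this one bound
  -- yields both conclusions.
  have hlin : ∫⁻ ω, ENNReal.ofReal (|F (q ω) (X ω) - f (q ω)| ^ 2) ∂P
      ≤ ENNReal.ofReal (σ ^ 2) := by
    calc _ = ∫⁻ p, ENNReal.ofReal (|F p.1 p.2 - f p.1| ^ 2) ∂(P.map fun ω => (q ω, X ω)) :=
          (lintegral_map hG.ennreal_ofReal (hq.prodMk hX)).symm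
      _ = ∫⁻ x, ∫⁻ z, ENNReal.ofReal (|F x z - f x| ^ 2) ∂(Ξ x) ∂(P.map q) := by
          rw [h.map_prodMk hX hq hqm, Measure.lintegral_compProd hG.ennreal_ofReal]
      _ ≤ ∫⁻ _, ENNReal.ofReal (σ ^ 2) ∂(P.map q) := by
          refine lintegral_mono fun x => ?_
          rw [← ofReal_integral_eq_lintegral_ofReal (hSZO.integrable_sq x)
            (Filter.Eventually.of_forall fun z => by positivity)]
          exact ENNReal.ofReal_le_ofReal (hSZO.variance x)
      _ = ENNReal.ofReal (σ ^ 2) := by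
          rw [lintegral_const, Measure.map_apply hq MeasurableSet.univ]
          simp
  have hmeas : AEStronglyMeasurable (fun ω => |F (q ω) (X ω) - f (q ω)| ^ 2) P :=
    (hG.comp (hq.prodMk hX)).aestronglyMeasurable
  have hnn : 0 ≤ᵐ[P] fun ω => |F (q ω) (X ω) - f (q ω)| ^ 2 :=
    Filter.Eventually.of_forall fun ω => by positivity
  refine ⟨(lintegral_ofReal_ne_top_iff_integrable hmeas hnn).mp
    (ne_top_of_le_ne_top ENNReal.ofReal_ne_top hlin), ?_⟩
  rw [integral_eq_lintegral_of_nonneg_ae hnn hmeas]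
  exact ENNReal.toReal_le_of_le_ofReal (sq_nonneg σ) hlin

theorem IsRun.noise_sq {d : ℕ} {Ω Z : Type*} [MeasurableSpace Ω] [MeasurableSpace Z]
    {F : E d → Z → ℝ} {Ξ : Kernel (E d) Z} [IsMarkovKernel Ξ] {f : E d → ℝ} {σ δ η : ℝ}
    {M K : ℕ} {P : Measure Ω} [IsProbabilityMeasure P]
    {s : ℕ → Ω → unitInterval} {u : ℕ → Ω → Sph d} {ξ : ℕ → Ω → Z}
    (hrun : IsRun F Ξ δ η M K P s u ξ) (hSZO : IsSZO F Ξ f σ)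
    (hF : Measurable (Function.uncurry F)) (hf : Measurable f) {t : ℕ} (ht : t ≤ K * M) :
    Integrable (fun ω => |F (query F δ η M s u ξ t ω) (ξ t ω)
        - f (query F δ η M s u ξ t ω)| ^ 2) P ∧
      ∫ ω, |F (query F δ η M s u ξ t ω) (ξ t ω)
        - f (query F δ η M s u ξ t ω)| ^ 2 ∂P ≤ σ ^ 2 :=
  hSZO.noise_sq hF hf (q := query F δ η M s u ξ t) (hrun.law_ξ t ht) (hrun.measurable_ξ t)
    (measurable_query hF δ η M t (fun i _ _ => hrun.measurable_s i)
      (fun i _ => hrun.measurable_u i) (fun i _ => hrun.measurable_ξ i))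
    (measurable_query (m := hist s u ξ (t + 1) (t + 1) t) hF δ η M t
      (fun _ h1 h2 => measurable_hist_s s u ξ h1 (Nat.lt_succ_of_le h2))
      (fun _ hi => measurable_hist_u s u ξ (Nat.lt_succ_of_le hi))
      (fun _ hi => measurable_hist_ξ s u ξ hi))

/-! ### Second moment of the gradient estimator -/

theorem norm_gIter_succ_sq {d : ℕ} {Z Ω : Type*} (F : E d → Z → ℝ) (δ η : ℝ) (M : ℕ)
    (s : ℕ → Ω → unitInterval) (u : ℕ → Ω → Sph d) (ξ : ℕ → Ω → Z) (t : ℕ) (ω : Ω) :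
    ‖gIter F δ η M s u ξ (t + 1) ω‖ ^ 2 = ((d : ℝ) / δ) ^ 2 *
      (F (query F δ η M s u ξ (t + 1) ω) (ξ (t + 1) ω)
        - F (query F δ η M s u ξ t ω) (ξ t ω)) ^ 2 := by
  have hu : ‖(u (t + 1) ω : E d)‖ = 1 := mem_sphere_zero_iff_norm.mp (u (t + 1) ω).2
  change ‖onePoint F δ (yIter F δ η M s u ξ (t + 1) ω) (u (t + 1) ω) (ξ (t + 1) ω)
    (yIter F δ η M s u ξ t ω) (u t ω) (ξ t ω)‖ ^ 2 = _
  rw [onePoint, norm_smul, hu, mul_one, Real.norm_eq_abs, sq_abs, mul_pow]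
  rfl

theorem norm_query_succ_sub_le {d : ℕ} {Z Ω : Type*} (F : E d → Z → ℝ) {δ : ℝ} (hδ : 0 ≤ δ)
    (η : ℝ) {M : ℕ} (hM : 1 ≤ M)
    (s : ℕ → Ω → unitInterval) (u : ℕ → Ω → Sph d) (ξ : ℕ → Ω → Z) (t : ℕ) (ω : Ω) :
    ‖query F δ η M s u ξ (t + 1) ω - query F δ η M s u ξ t ω‖ ≤ 4 * δ := by
  have hy := norm_state_y_succ_sub_le F η M (s · ω) (u · ω) (ξ · ω) hδ t
  have hDδ : δ / M ≤ δ := div_le_self hδ (by exact_mod_cast hM)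
  have hu : ∀ i, ‖δ • (u i ω : E d)‖ = δ := fun i => by
    rw [norm_smul, mem_sphere_zero_iff_norm.mp (u i ω).2, mul_one, Real.norm_of_nonneg hδ]
  calc _ = ‖(yIter F δ η M s u ξ (t + 1) ω - yIter F δ η M s u ξ t ω)
          + (δ • (u (t + 1) ω : E d) - δ • (u t ω : E d))‖ := by
        simp only [query]; congr 1; abel
    _ ≤ 2 * (δ / M) + (δ + δ) := (norm_add_le _ _).trans
        (add_le_add hy ((norm_sub_le _ _).trans_eq (by rw [hu, hu])))
    _ ≤ 4 * δ := by linarith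

end ZOO2NC

open ZOO2NC in
theorem integral_norm_gIter_succ_sq_le {d : ℕ} {Z Ω : Type*} [MeasurableSpace Z]
    [MeasurableSpace Ω] {F : E d → Z → ℝ} (hF : Measurable (Function.uncurry F))
    {Ξ : Kernel (E d) Z} [IsMarkovKernel Ξ] {f : E d → ℝ} {σ L : ℝ}
    (hSZO : IsSZO F Ξ f σ) (hLip : ∀ x y : E d, |f x - f y| ≤ L * ‖x - y‖)
    {δ η : ℝ} (hδ : 0 < δ) {M K : ℕ} (hM : 1 ≤ M) {P : Measure Ω} [IsProbabilityMeasure P]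
    {s : ℕ → Ω → unitInterval} {u : ℕ → Ω → Sph d} {ξ : ℕ → Ω → Z}
    (hrun : IsRun F Ξ δ η M K P s u ξ) {t : ℕ} (ht : t + 1 ≤ K * M) :
    Integrable (fun ω => ‖gIter F δ η M s u ξ (t + 1) ω‖ ^ 2) P ∧
      ∫ ω, ‖gIter F δ η M s u ξ (t + 1) ω‖ ^ 2 ∂P
        ≤ 6 * (d : ℝ) ^ 2 * σ ^ 2 / δ ^ 2 + 48 * (d : ℝ) ^ 2 * L ^ 2 := by
  -- The sign of `L` is not assumed; `|L|` is a nonnegative Lipschitz constant with the same square.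
  have hLip' : ∀ x y : E d, |f x - f y| ≤ |L| * ‖x - y‖ := fun x y =>
    (hLip x y).trans (by gcongr; exact le_abs_self L)
  have hf : Measurable f := by
    refine (LipschitzWith.of_dist_le_mul (K := Real.nnabs L) fun x y => ?_).continuous.measurable
    simpa [Real.dist_eq, dist_eq_norm] using hLip' x y
  obtain ⟨hi1, hb1⟩ := hrun.noise_sq hSZO hF hf ht
  obtain ⟨hi0, hb0⟩ := hrun.noise_sq hSZO hF hf (t := t) (by omega)
  set N : ℕ → Ω → ℝ := fun i ω => |F (query F δ η M s u ξ i ω) (ξ i ω)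
    - f (query F δ η M s u ξ i ω)| ^ 2 with hN
  -- Integrable pathwise majorant; `48 = 3 · 4²`, from three terms and query points at distance at
  -- most `4δ`.
  let B : Ω → ℝ := fun ω => ((d : ℝ) / δ) ^ 2 *
    (3 * N (t + 1) ω + 3 * N t ω + 48 * δ ^ 2 * L ^ 2)
  have hB : Integrable B P :=
    (((hi1.const_mul 3).add (hi0.const_mul 3)).add (integrable_const _)).const_mul _
  have hle : ∀ ω, ‖gIter F δ η M s u ξ (t + 1) ω‖ ^ 2 ≤ B ω := fun ω => by
    rw [norm_gIter_succ_sq]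
    refine mul_le_mul_of_nonneg_left ?_ (sq_nonneg _)
    have hz := norm_query_succ_sub_le F hδ.le η hM s u ξ t ω
    simp only [hN, sq_abs]
    set z₁ := query F δ η M s u ξ (t + 1) ω
    set z₀ := query F δ η M s u ξ t ω
    have hsq : (f z₁ - f z₀) ^ 2 ≤ 16 * δ ^ 2 * L ^ 2 := by
      have h1 : |f z₁ - f z₀| ≤ |L| * (4 * δ) := (hLip' z₁ z₀).trans (by gcongr)
      calc (f z₁ - f z₀) ^ 2 = |f z₁ - f z₀| ^ 2 := (sq_abs _).symm
        _ ≤ (|L| * (4 * δ)) ^ 2 := by gcongr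
        _ = 16 * δ ^ 2 * L ^ 2 := by rw [mul_pow, sq_abs]; ring
    -- The gap between the two sides is exactly `(a + b)² + (a - c)² + (b + c)²`.
    have hsum : ∀ a b c : ℝ, (a - b + c) ^ 2 ≤ 3 * a ^ 2 + 3 * b ^ 2 + 3 * c ^ 2 :=
      fun a b c => by nlinarith [sq_nonneg (a + b), sq_nonneg (a - c), sq_nonneg (b + c)]
    have h3 := hsum (F z₁ (ξ (t + 1) ω) - f z₁) (F z₀ (ξ t ω) - f z₀) (f z₁ - f z₀)
    calc _ = (F z₁ (ξ (t + 1) ω) - f z₁ - (F z₀ (ξ t ω) - f z₀) + (f z₁ - f z₀)) ^ 2 := by ring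
      _ ≤ _ := by linarith
  have hgm : Measurable (gIter F δ η M s u ξ (t + 1)) :=
    ((measurable_state hF δ η M (t + 1) (fun i _ _ => hrun.measurable_s i)
      (fun i _ => hrun.measurable_u i) (fun i _ => hrun.measurable_ξ i)).2.2
      (hrun.measurable_u _) (hrun.measurable_ξ _)).1
  have hg : Integrable (fun ω => ‖gIter F δ η M s u ξ (t + 1) ω‖ ^ 2) P :=
    hB.mono' (hgm.norm.pow_const 2).aestronglyMeasurable
      (Filter.Eventually.of_forall fun ω => by
        rw [Real.norm_of_nonneg (by positivity)]; exact hle ω)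
  refine ⟨hg, (integral_mono hg hB hle).trans ?_⟩
  have hBint : ∫ ω, B ω ∂P = ((d : ℝ) / δ) ^ 2 *
      (3 * ∫ ω, N (t + 1) ω ∂P + 3 * ∫ ω, N t ω ∂P + 48 * δ ^ 2 * L ^ 2) := by
    simp only [B]
    have hi : Integrable (fun ω => 3 * N (t + 1) ω + 3 * N t ω) P :=
      (hi1.const_mul 3).add (hi0.const_mul 3)
    rw [integral_const_mul, integral_add hi (integrable_const _),
      integral_add (hi1.const_mul 3) (hi0.const_mul 3), integral_const_mul, integral_const_mul,
      integral_const, probReal_univ, one_smul]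
  rw [hBint]
  calc _ ≤ ((d : ℝ) / δ) ^ 2 * (3 * σ ^ 2 + 3 * σ ^ 2 + 48 * δ ^ 2 * L ^ 2) := by gcongr
    _ = _ := by field_simp; ring

theorem lemma3p3 {d : ℕ} (hd : 1 ≤ d) {Z Ω : Type*} [MeasurableSpace Z] [MeasurableSpace Ω]
    (F : ZOO2NC.E d → Z → ℝ) (hF : Measurable (Function.uncurry F))
    (Ξ : Kernel (ZOO2NC.E d) Z) [IsMarkovKernel Ξ]
    (f : ZOO2NC.E d → ℝ) (σ L : ℝ)
    (hSZO : ZOO2NC.IsSZO F Ξ f σ)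
    (hLip : ∀ x y : ZOO2NC.E d, |f x - f y| ≤ L * ‖x - y‖)
    (δ η : ℝ) (hδ : 0 < δ) (hη : 0 < η) (M K : ℕ) (hM : 1 ≤ M)
    (P : Measure Ω) [IsProbabilityMeasure P]
    (s : ℕ → Ω → unitInterval) (u : ℕ → Ω → ZOO2NC.Sph d) (ξ : ℕ → Ω → Z)
    (hrun : ZOO2NC.IsRun F Ξ δ η M K P s u ξ) :
    ∀ t : ℕ, 1 ≤ t → t ≤ K * M →
      (∀ ω, ‖ZOO2NC.yIter F δ η M s u ξ t ω - ZOO2NC.yIter F δ η M s u ξ (t - 1) ω‖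
        ≤ 2 * (δ / M)) ∧
      Integrable (fun ω => ‖ZOO2NC.gIter F δ η M s u ξ t ω‖ ^ 2) P ∧
      ∫ ω, ‖ZOO2NC.gIter F δ η M s u ξ t ω‖ ^ 2 ∂P
        ≤ 6 * (d : ℝ) ^ 2 * σ ^ 2 / δ ^ 2 + 385 * (d : ℝ) ^ 2 * L ^ 2 := by
  intro t ht htT
  obtain ⟨t, rfl⟩ := Nat.exists_eq_succ_of_ne_zero (Nat.one_le_iff_ne_zero.mp ht)
  obtain ⟨hint, hle⟩ := integral_norm_gIter_succ_sq_le hF hSZO hLip hδ hM hrun htT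
  refine ⟨fun ω => ZOO2NC.norm_state_y_succ_sub_le F η M (s · ω) (u · ω) (ξ · ω) hδ.le t,
    hint, hle.trans ?_⟩
  -- What remains is `48 ≤ 385`.
  gcongr
  norm_num
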